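/- **Theorem 3.1.** Let $m\ge 1$ and let the $n$ entries of a signal $x\in\mathbb{C}^n$ be indexed by a finite abelian group $G$ with $|G|=n$ (e.g. $\mathbb{Z}/n$, or $\mathbb{Z}/n_1\times\mathbb{Z}/n_2$ for images). Let $A=[a_1,\dots,a_m]\in\mathbb{C}^{n\times m}$, $b\in\mathbb{R}^m$ with $b_{\min}=\min_i b_i>0$, and let $x^\natural\in\mathbb{C}^n$ solve the noiseless phase retrieval problem $|a_i^*x^\natural|=b_i$, $i=1,\dots,m$. Put $y^\natural=A^*x^\natural$ and $z^\natural=(x^\natural,y^\natural)\in\mathbb{C}^{n+m}$. Assume: 1. $A^*$ has full column rank; 2. every $x\in\mathbb{C}^n$ with $|a_i^*x|=b_i$ for all $i$ is obtained from $x^\natural$ by trivial ambiguities, i.e. there are $\alpha\in\mathbb{C}$ with $|\alpha|=1$ and $l\in G$ with $x_j=\alpha x^\natural_{j-l}$ for all $j\in G$, or $x_j=\alpha\overline{x^\natural_{l-j}}$ for all $j\in G$; 3. every $x\in\mathbb{C}^n$ with $a_i^*x\neq 0$ and $\frac{a_i^*x}{|a_i^*x|}=\pm\frac{a_i^*x^\natural}{|a_i^*x^\natural|}$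 for all $i$ (the signs may depend on $i$) is of the form $x=cx^\natural$ with $c\in\mathbb{R}\setminus\{0\}$. Graph projection splitting (GPS) without prior ($g=0$) generates, from arbitrary $x^0,\lambda^0\in\mathbb{C}^n$ and $y^0,\nu^0\in\mathbb{C}^m$, for $k\ge 0$, $$(x^{k+\frac12},y^{k+\frac12})=\Pi_{A^*}(x^k-\lambda^k,\,y^k-\nu^k),\qquad x^{k+1}=x^{k+\frac12}+\lambda^k,\qquad y^{k+1}=b\circ\frac{y^{k+\frac12}+\nu^k}{|y^{k+\frac12}+\nu^k|},$$ $$\lambda^{k+1}=\lambda^k+x^{k+\frac12}-x^{k+1},\qquad \nu^{k+1}=\nu^k+y^{k+\frac12}-y^{k+1},$$ where $\Pi_{A^*}$ is the orthogonal projection of $\mathbb{C}^{n+m}$ onto $\{(x,y): A^*x=y\}$, and operations on vectors are entrywise with $0/|0|:=0$. Put $z_{\mathrm{DR}}^k=(\lambda^k+x^k,\ \nu^k+y^k)$, $\operatorname{dist}(x,x^\natural)=\min_{|\alpha|=1}\|x-\alpha x^\natural\|$, and $$\mathcal{F}=\Big\{\Big(\alpha x^\natural,\ \alpha(b+\theta)\circ\tfrac{y^\natural}{|y^\natural|}\Big)\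 :\ |\alpha|=1,\ \theta\in\mathbb{R}^m,\ A\big(\theta\circ\tfrac{y^\natural}{|y^\natural|}\big)=0,\ b+\theta\ge 0\Big\}.$$ Then there are a (sufficiently small) $\varepsilon_3$ with $0<\varepsilon_3<b_{\min}/6$ and a constant $0<\gamma<1$ such that for every GPS iteration with $\|z_{\mathrm{DR}}^1-z^\natural\|\le\varepsilon_3$, the point $z_{\mathrm{DR}}^1$ has a projection (nearest point) onto $\mathcal{F}$, and for every such projection $z_*^1$ and every $k\ge 1$, $$\operatorname{dist}(x^k,x^\natural)\le\gamma^{k-1}\|z_{\mathrm{DR}}^1-z_*^1\|\le\gamma^{k-1}\|z_{\mathrm{DR}}^1-z^\natural\|.$$ -/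

import Mathlib

open scoped Matrix ComplexConjugate

noncomputable section

namespace PhaseRetrieval

variable {G : Type*} [Fintype G] {m : ℕ}

/-- The stacked space `ℂⁿ × ℂᵐ` of pairs `z = (x, y)`, with the Euclidean norm of `ℂⁿ⁺ᵐ`.
The `n` entries of a signal are indexed by a finite type `G`. -/
abbrev Stacked (G : Type*) (m : ℕ) : Type _ :=
  WithLp 2 (EuclideanSpace ℂ G × EuclideanSpace ℂ (Fin m))

/-- The pair `(x, y)` as an element of the stacked space. -/
def stack (x : EuclideanSpace ℂ G) (y : EuclideanSpace ℂ (Fin m)) : Stacked G m :=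
  WithLp.toLp 2 (x, y)

/-- `A* x`, whose `i`-th entry is `aᵢ* x`, where `aᵢ` is the `i`-th column of `A`. -/
def meas (A : Matrix G (Fin m) ℂ) (x : EuclideanSpace ℂ G) : EuclideanSpace ℂ (Fin m) :=
  WithLp.toLp 2 (Aᴴ *ᵥ x.ofLp)

/-- `b_min = min {b₁, …, b_m}`. (It is `0` if `m = 0`, so `0 < bMin b` includes `m ≥ 1`.) -/
def bMin (b : Fin m → ℝ) : ℝ := ⨅ i, b i

/-- The phase `y / |y|` of a complex number, with value `0` at `y = 0`. -/
def phase (y : ℂ) : ℂ := y / (‖y‖ : ℂ)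

/-- `x` solves the noiseless phase retrieval problem `|aᵢ* x| = bᵢ` for all `i`. -/
def IsSolution (A : Matrix G (Fin m) ℂ) (b : Fin m → ℝ) (x : EuclideanSpace ℂ G) : Prop :=
  ∀ i, ‖meas A x i‖ = b i

/-- `x'` arises from `x` by the trivial ambiguities: a global phase shift `α`, a (cyclic)
translation by `l`, and possibly a (conjugate) mirror flip. The entries of a signal are indexed
by a finite abelian group, such as `ℤ/n` for one-dimensional signals or `ℤ/n₁ × ℤ/n₂` for
images. -/
def TriviallyEquivalent [AddCommGroup G] (x x' : EuclideanSpace ℂ G) : Prop :=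
  ∃ α : ℂ, ‖α‖ = 1 ∧ ∃ l : G,
    (∀ j, x' j = α * x (j - l)) ∨ (∀ j, x' j = α * conj (x (l - j)))

/-- The assumption on the sampling vectors. -/
structure SamplingAssumption [AddCommGroup G] (A : Matrix G (Fin m) ℂ) (b : Fin m → ℝ)
    (xnat : EuclideanSpace ℂ G) : Prop where
  /-- `A*` has full column rank. -/
  full_rank : Aᴴ.rank = Fintype.card G
  /-- The solution of phase retrieval is unique up to the trivial ambiguities. -/
  phase_unique : ∀ x, IsSolution A b x → TriviallyEquivalent xnat x
  /-- The solution of magnitude retrieval is unique up to a nonzero real factor. -/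
  magnitude_unique : ∀ x : EuclideanSpace ℂ G,
    (∀ i, phase (meas A x i) = phase (meas A xnat i) ∨
      phase (meas A x i) = -phase (meas A xnat i)) →
    ∃ c : ℝ, c ≠ 0 ∧ x = (c : ℂ) • xnat

/-- The graph set `C = {(x, y) | A* x = y}`, a complex subspace of the stacked space. -/
def graphSet (A : Matrix G (Fin m) ℂ) : Submodule ℂ (Stacked G m) where
  carrier := {z | meas A z.fst = z.snd}
  add_mem' := by
    intro z w hz hw
    simp only [Set.mem_ofPred_eq, meas, WithLp.add_fst, WithLp.add_snd] at *
    rw [← hz, ← hw, WithLp.ofLp_add, Matrix.mulVec_add, WithLp.toLp_add]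
  zero_mem' := by
    simp [meas]
  smul_mem' := by
    intro c z hz
    simp only [Set.mem_ofPred_eq, meas, WithLp.smul_fst, WithLp.smul_snd] at *
    rw [← hz, WithLp.ofLp_smul, Matrix.mulVec_smul, WithLp.toLp_smul]

/-- The graph projection, i.e. the orthogonal projection onto the graph set. -/
def graphProj (A : Matrix G (Fin m) ℂ) (z : Stacked G m) : Stacked G m :=
  (graphSet A).starProjection z

/-- The proximity operator of the indicator function `f` of `{y | |y| = b}`:
`prox_f(y) = b ∘ y / |y|`, with the convention `yᵢ / |yᵢ| = 0` where `yᵢ = 0`. -/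
def proxF (b : Fin m → ℝ) (y : EuclideanSpace ℂ (Fin m)) : EuclideanSpace ℂ (Fin m) :=
  WithLp.toLp 2 fun i => (b i : ℂ) * phase (y i)

/-- The proximity operator of `g = 0`, the minimizer of `p ↦ ρ / 2 * ‖p - x‖ ^ 2`. -/
def proxG (x : EuclideanSpace ℂ G) : EuclideanSpace ℂ G := x

/-- The sequences `xᵏ, yᵏ` (primal), `lamᵏ, nuᵏ` (dual) and `xhᵏ = x^{k+1/2}, yhᵏ = y^{k+1/2}`
are generated by graph projection splitting with `g = 0`, from arbitrary initial values
`x⁰, y⁰, lam⁰, nu⁰`. -/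
structure IsGPS (A : Matrix G (Fin m) ℂ) (b : Fin m → ℝ)
    (x xh lam : ℕ → EuclideanSpace ℂ G) (y yh nu : ℕ → EuclideanSpace ℂ (Fin m)) : Prop where
  graph_step : ∀ k, stack (xh k) (yh k) = graphProj A (stack (x k - lam k) (y k - nu k))
  prox_x : ∀ k, x (k + 1) = proxG (xh k + lam k)
  prox_y : ∀ k, y (k + 1) = proxF b (yh k + nu k)
  dual_x : ∀ k, lam (k + 1) = lam k + xh k - x (k + 1)
  dual_y : ∀ k, nu (k + 1) = nu k + yh k - y (k + 1)

/-- The set `𝓕` of the points `(α x♮, α (b + θ) ∘ y♮ / |y♮|)` with `y♮ = A* x♮`, `|α| = 1`,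
`θ ∈ ℝᵐ`, `A (θ ∘ y♮ / |y♮|) = 0` and `b + θ ≥ 0`. -/
def fixedSet (A : Matrix G (Fin m) ℂ) (b : Fin m → ℝ) (xnat : EuclideanSpace ℂ G) :
    Set (Stacked G m) :=
  {z | ∃ (α : ℂ) (θ : Fin m → ℝ), ‖α‖ = 1 ∧
    A *ᵥ (fun i => (θ i : ℂ) * phase (meas A xnat i)) = 0 ∧
    (∀ i, 0 ≤ b i + θ i) ∧
    z = stack (α • xnat)
      (WithLp.toLp 2 fun i => α * ((b i + θ i : ℝ) : ℂ) * phase (meas A xnat i))}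

/-- `p` is a projection of `z` onto the set `S`, i.e. `p ∈ argmin_{q ∈ S} ‖q - z‖²`. -/
def IsProjOn (S : Set (Stacked G m)) (z p : Stacked G m) : Prop :=
  p ∈ S ∧ ∀ q ∈ S, ‖p - z‖ ^ 2 ≤ ‖q - z‖ ^ 2

/-- `dist(x, x♮) = min_{|α| = 1} ‖x - α x♮‖`. -/
def phaseDist (x xnat : EuclideanSpace ℂ G) : ℝ :=
  ⨅ α : Circle, ‖x - (α : ℂ) • xnat‖

end PhaseRetrieval

end

/-!
In the variable `z_DR`, and from `k = 1` on, graph projection splitting is the Douglas-Rachford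
iteration for the graph set and the magnitude constraint `|y| = b`. At `z♮` the proximity operator
of the magnitude constraint is strictly differentiable, and its derivative is the orthogonal
projection onto the tangent space `M` of the constraint. Hence the step linearizes to the
Douglas-Rachford operator of the subspaces `K` (the graph set) and `M`, which strictly shrinks
every vector orthogonal to its fixed space `(K ⊓ M) ⊔ (Kᗮ ⊓ Mᗮ)`. Uniqueness of magnitude retrieval
gives `K ⊓ M ⊆ ℝ i z♮`, the direction of the global phase, while `Kᗮ ⊓ Mᗮ` consists of the
directions `θ` of `𝓕`. So the displacement of a point to its projection onto `𝓕` is orthogonal to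
the fixed space, exactly in the directions `θ` and up to a small error in the phase direction, and
the step contracts the distance to `𝓕`. Rotations commute with the step, which reduces everything
to the slice `α = 1` of `𝓕`; the geometric decay keeps the iterates near `z♮`.
-/

noncomputable section

namespace PhaseRetrieval

open Filter Topology Metric
open scoped RealInnerProductSpace Pointwise ComplexOrder

theorem norm_lt_one_of_forall_norm_apply_lt {𝕜 E F : Type*} [RCLike 𝕜]
    [NormedAddCommGroup E] [NormedSpace 𝕜 E] [FiniteDimensional 𝕜 E]
    [NormedAddCommGroup F] [NormedSpace 𝕜 F] (T : E →L[𝕜] F)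
    (hT : ∀ v ≠ 0, ‖T v‖ < ‖v‖) : ‖T‖ < 1 := by
  have := FiniteDimensional.proper_rclike 𝕜 E
  obtain hE | hne := (sphere (0 : E) 1).eq_empty_or_nonempty
  · have : ‖T‖ ≤ 0 := T.opNorm_le_of_unit_norm le_rfl fun v hv =>
      absurd (mem_sphere_zero_iff_norm.2 hv) (by simp [hE])
    linarith
  · obtain ⟨v, hv, hmax⟩ := (isCompact_sphere (0 : E) 1).exists_isMaxOn hne
      T.continuous.norm.continuousOn
    have hv1 : ‖v‖ = 1 := mem_sphere_zero_iff_norm.1 hv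
    have hv0 : v ≠ 0 := fun h => by simp [h] at hv1
    calc ‖T‖ ≤ ‖T v‖ := T.opNorm_le_of_unit_norm (norm_nonneg _) fun u hu =>
          hmax (mem_sphere_zero_iff_norm.2 hu)
      _ < ‖v‖ := hT v hv0
      _ = 1 := hv1

theorem norm_starProjection_mul_norm_le {E : Type*} [NormedAddCommGroup E]
    [InnerProductSpace ℝ E] {N : Submodule ℝ E} [N.HasOrthogonalProjection] {u : E}
    (hN : N ≤ ℝ ∙ u) (v : E) :
    ‖N.starProjection v‖ * ‖u‖ ≤ |⟪u, v⟫| := by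
  obtain ⟨c, hc⟩ := Submodule.mem_span_singleton.1 (hN (N.starProjection_apply_mem v))
  have hsq : c * ⟪u, v⟫ = ‖N.starProjection v‖ ^ 2 := by
    have h := N.starProjection_inner_eq_zero v _ (N.starProjection_apply_mem v)
    rw [inner_sub_left, sub_eq_zero, real_inner_self_eq_norm_sq] at h
    rw [← h, ← hc, real_inner_smul_right, real_inner_comm]
  obtain rfl | hc0 := eq_or_ne c 0
  · simp [← hc]
  · have hnorm : ‖N.starProjection v‖ = |c| * ‖u‖ := by rw [← hc, norm_smul, Real.norm_eq_abs]
    refine le_of_mul_le_mul_left (a := |c|) (Eq.le ?_) (abs_pos.2 hc0)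
    calc |c| * (‖N.starProjection v‖ * ‖u‖) = ‖N.starProjection v‖ ^ 2 := by rw [hnorm]; ring
      _ = |c| * |⟪u, v⟫| := by rw [← abs_mul, hsq, abs_of_nonneg (sq_nonneg _)]

section Circle

variable {E : Type*} [NormedAddCommGroup E]

theorem norm_sub_le_norm_circle_smul_sub [InnerProductSpace ℂ E] {q z : E}
    (h : 0 ≤ inner ℂ q z) (α : Circle) : ‖q - z‖ ≤ ‖α • q - z‖ := by
  have hre : RCLike.re (inner ℂ (α • q) z) ≤ RCLike.re (inner ℂ q z) :=
    calc RCLike.re (inner ℂ (α • q) z) ≤ ‖inner ℂ (α • q) z‖ := RCLike.re_le_norm _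
      _ = ‖inner ℂ q z‖ := by
        rw [Circle.smul_def, inner_smul_left, norm_mul, RCLike.norm_conj, Circle.norm_coe, one_mul]
      _ = RCLike.re (inner ℂ q z) := (Complex.re_eq_norm.2 h).symm
  refine le_of_sq_le_sq ?_ (norm_nonneg _)
  rw [norm_sub_sq (𝕜 := ℂ), norm_sub_sq (𝕜 := ℂ), Circle.norm_smul]
  linarith

theorem hasDerivAt_circle_exp_smul [NormedSpace ℂ E] (p : E) :
    HasDerivAt (fun t : ℝ => Circle.exp t • p) (Complex.I • p) 0 := by
  have hexp : HasDerivAt (fun t : ℝ => Complex.exp (t * Complex.I)) Complex.I 0 := by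
    simpa using ((Complex.ofRealCLM.hasDerivAt (x := 0)).mul_const Complex.I).cexp
  simpa only [Circle.smul_def, Circle.coe_exp] using hexp.smul_const p

theorem isClosed_univ_circle_smul [NormedSpace ℂ E] {S : Set E} (hS : IsClosed S) :
    IsClosed ((Set.univ : Set Circle) • S) :=
  hS.smul_left_of_isCompact isCompact_univ

end Circle

section DouglasRachford

variable {E : Type*} [NormedAddCommGroup E] [InnerProductSpace ℝ E]

/-- The Douglas-Rachford operator `z ↦ z - P z + Π_K (2 P z - z)` for the subspace `K` and a map `P`
in the role of a proximity operator. -/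
def douglasRachford (K : Submodule ℝ E) [K.HasOrthogonalProjection] (P : E → E) (z : E) : E :=
  z - P z + K.starProjection (2 • P z - z)

/-- The Douglas-Rachford operator of a continuous linear map `P`, as a continuous linear map; it
is the derivative of `douglasRachford K` at a point where the nonlinear map has derivative `P`. -/
def douglasRachfordCLM (K : Submodule ℝ E) [K.HasOrthogonalProjection] (P : E →L[ℝ] E) :
    E →L[ℝ] E :=
  .id ℝ E - P + K.starProjection ∘L (2 • P - .id ℝ E)

variable (K L : Submodule ℝ E) [K.HasOrthogonalProjection] [L.HasOrthogonalProjection]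

theorem douglasRachford_eq_self {K : Submodule ℝ E} [K.HasOrthogonalProjection] {P : E → E}
    {z : E} (hP : P z ∈ K) (hz : z - P z ∈ Kᗮ) : douglasRachford K P z = z := by
  have hsplit : 2 • P z - z = P z - (z - P z) := by module
  rw [douglasRachford, hsplit, map_sub, K.starProjection_eq_self_iff.2 hP,
    K.starProjection_apply_eq_zero_iff.2 hz]
  abel

theorem hasStrictFDerivAt_douglasRachford {P : E → E} {P' : E →L[ℝ] E} {z : E}
    (hP : HasStrictFDerivAt P P' z) :
    HasStrictFDerivAt (douglasRachford K P) (douglasRachfordCLM K P') z :=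
  ((hasStrictFDerivAt_id z).sub hP).add
    (K.starProjection.hasStrictFDerivAt.comp z ((hP.const_smul 2).sub (hasStrictFDerivAt_id z)))

theorem douglasRachfordCLM_starProjection_apply (v : E) :
    douglasRachfordCLM K L.starProjection v =
      v - L.starProjection v + K.starProjection (L.reflection v) := by
  simp [douglasRachfordCLM, L.reflection_apply]

theorem two_smul_douglasRachfordCLM_starProjection (v : E) :
    (2 : ℝ) • douglasRachfordCLM K L.starProjection v =
      v + K.reflection (L.reflection v) := by
  rw [douglasRachfordCLM_starProjection_apply, K.reflection_apply, L.reflection_apply]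
  module

theorem norm_sq_douglasRachfordCLM_starProjection (v : E) :
    ‖douglasRachfordCLM K L.starProjection v‖ ^ 2
      + ‖v - douglasRachfordCLM K L.starProjection v‖ ^ 2 = ‖v‖ ^ 2 := by
  have h2 := two_smul_douglasRachfordCLM_starProjection K L v
  generalize douglasRachfordCLM K L.starProjection v = t at *
  have hR : ‖(2 : ℝ) • t - v‖ ^ 2 = ‖v‖ ^ 2 := by
    rw [h2, add_sub_cancel_left, LinearIsometryEquiv.norm_map, LinearIsometryEquiv.norm_map]
  have hpar := parallelogram_law_with_norm ℝ t (t - v)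
  rw [show t + (t - v) = (2 : ℝ) • t - v by module, sub_sub_cancel, norm_sub_rev t v] at hpar
  linarith

theorem mem_sup_of_douglasRachfordCLM_starProjection_eq_self {v : E}
    (hv : douglasRachfordCLM K L.starProjection v = v) : v ∈ K ⊓ L ⊔ Kᗮ ⊓ Lᗮ := by
  have hKL : K.starProjection (L.reflection v) = L.starProjection v := by
    rw [douglasRachfordCLM_starProjection_apply, sub_add_eq_add_sub, sub_eq_iff_eq_add] at hv
    exact add_left_cancel hv
  refine Submodule.mem_sup.2 ⟨L.starProjection v, ⟨?_, L.starProjection_apply_mem v⟩,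
    v - L.starProjection v, ⟨?_, L.sub_starProjection_mem_orthogonal v⟩, add_sub_cancel _ _⟩
  · exact hKL ▸ K.starProjection_apply_mem _
  · have := K.sub_starProjection_mem_orthogonal (L.reflection v)
    rw [hKL, L.reflection_apply] at this
    exact (Submodule.neg_mem_iff _).1 (by convert this using 1; module)

theorem douglasRachfordCLM_starProjection_eq_self_of_mem_inf {v : E} (hv : v ∈ K ⊓ L) :
    douglasRachfordCLM K L.starProjection v = v := by
  rw [douglasRachfordCLM_starProjection_apply, L.reflection_mem_subspace_eq_self hv.2,
    L.starProjection_eq_self_iff.2 hv.2, K.starProjection_eq_self_iff.2 hv.1]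
  abel

theorem norm_douglasRachfordCLM_starProjection_lt {v : E} (hv : v ∈ (K ⊓ L ⊔ Kᗮ ⊓ Lᗮ)ᗮ)
    (hv0 : v ≠ 0) : ‖douglasRachfordCLM K L.starProjection v‖ < ‖v‖ := by
  have hne : v - douglasRachfordCLM K L.starProjection v ≠ 0 := fun h => hv0 <|
    inner_self_eq_zero.1 (hv v
      (mem_sup_of_douglasRachfordCLM_starProjection_eq_self K L (sub_eq_zero.1 h).symm))
  refine lt_of_pow_lt_pow_left₀ 2 (norm_nonneg v) ?_
  rw [← norm_sq_douglasRachfordCLM_starProjection K L v]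
  exact lt_add_of_pos_right _ (pow_pos (norm_pos_iff.2 hne) 2)

theorem exists_norm_douglasRachfordCLM_le [FiniteDimensional ℝ E] :
    ∃ γ, 0 ≤ γ ∧ γ < 1 ∧ ∀ v ∈ (Kᗮ ⊓ Lᗮ)ᗮ,
      ‖douglasRachfordCLM K L.starProjection v‖ ≤ γ * ‖v‖ + ‖(K ⊓ L).starProjection v‖ := by
  set T := douglasRachfordCLM K L.starProjection
  set S := T ∘L (K ⊓ L ⊔ Kᗮ ⊓ Lᗮ)ᗮ.subtypeL
  have hS : ‖S‖ < 1 := norm_lt_one_of_forall_norm_apply_lt _ fun v hv =>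
    norm_douglasRachfordCLM_starProjection_lt K L v.2 (by simpa using hv)
  refine ⟨‖S‖, norm_nonneg S, hS, fun v hv => ?_⟩
  set w := (K ⊓ L).starProjection v
  have hw : w ∈ K ⊓ L := (K ⊓ L).starProjection_apply_mem v
  have hmem : v - w ∈ (K ⊓ L ⊔ Kᗮ ⊓ Lᗮ)ᗮ := by
    rw [← Submodule.inf_orthogonal]
    refine ⟨(K ⊓ L).sub_starProjection_mem_orthogonal v, sub_mem hv ?_⟩
    exact fun u hu => (real_inner_comm _ _).trans (hu.1 w hw.1)
  calc ‖T v‖ = ‖T (v - w) + w‖ := by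
        rw [map_sub, douglasRachfordCLM_starProjection_eq_self_of_mem_inf K L hw, sub_add_cancel]
    _ ≤ ‖T (v - w)‖ + ‖w‖ := norm_add_le _ _
    _ ≤ ‖S‖ * ‖v - w‖ + ‖w‖ := by
      gcongr
      exact S.le_opNorm ⟨v - w, hmem⟩
    _ ≤ ‖S‖ * ‖v‖ + ‖w‖ := by
      gcongr
      rw [← (K ⊓ L).starProjection_orthogonal_val]
      exact (K ⊓ L)ᗮ.norm_starProjection_apply_le v

end DouglasRachford

section Calculus

variable {E : Type*} [NormedAddCommGroup E] [InnerProductSpace ℝ E]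

theorem hasStrictFDerivAt_normalize {x : E} (hx : x ≠ 0) :
    HasStrictFDerivAt NormedSpace.normalize
      (‖x‖⁻¹ • (.id ℝ E - (innerSL ℝ (NormedSpace.normalize x)).smulRight
        (NormedSpace.normalize x))) x := by
  have hx' : ‖x‖ ≠ 0 := norm_ne_zero_iff.2 hx
  have hnorm : HasStrictFDerivAt (fun y : E => ‖y‖) (innerSL ℝ (NormedSpace.normalize x)) x := by
    have h := (hasStrictFDerivAt_norm_sq x).sqrt (by positivity)
    simp only [Real.sqrt_sq (norm_nonneg _)] at h
    convert h using 1
    ext v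
    simp only [NormedSpace.normalize, map_smul, smul_apply, coe_innerSL_apply, smul_eq_mul,
      one_div, mul_inv_rev, nsmul_eq_mul, Nat.cast_ofNat]
    field_simp
  have hinv : HasStrictFDerivAt (fun y : E => ‖y‖⁻¹)
      (-(‖x‖ ^ 2)⁻¹ • innerSL ℝ (NormedSpace.normalize x)) x :=
    (hasStrictDerivAt_inv hx').comp_hasStrictFDerivAt x hnorm
  refine HasStrictFDerivAt.congr_fderiv (hinv.smul (hasStrictFDerivAt_id x)) ?_
  ext v
  simp only [NormedSpace.normalize, map_smul, neg_smul, add_apply, smul_apply,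
    ContinuousLinearMap.id_apply, ContinuousLinearMap.smulRight_apply, neg_apply,
    coe_innerSL_apply, smul_eq_mul, sub_apply]
  module

theorem inner_sub_eq_zero_of_isLocalMin_norm_sub {c : ℝ → E} {c' z : E} {t : ℝ}
    (hc : HasDerivAt c c' t) (hmin : IsLocalMin (fun s => ‖c s - z‖) t) : ⟪c', z - c t⟫ = 0 := by
  have hmin2 : IsLocalMin (fun s => ‖c s - z‖ ^ 2) t :=
    hmin.mono fun s hs => pow_le_pow_left₀ (norm_nonneg _) hs 2
  have h := hmin2.hasDerivAt_eq_zero (hc.sub_const z).norm_sq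
  rw [real_inner_comm, ← neg_sub (c t), inner_neg_left]
  linarith

end Calculus

theorem dist_le_and_le_pow_mul_of_contracting {X : Type*} [PseudoMetricSpace X] {u : ℕ → X} {a : X}
    {d : ℕ → ℝ} {ε γ C : ℝ} (hd : ∀ k, 0 ≤ d k) (hC : 0 ≤ C) (hγ : 0 ≤ γ) (hγ1 : γ < 1)
    (hstep : ∀ k, dist (u k) a ≤ ε → dist (u (k + 1)) (u k) ≤ C * d k ∧ d (k + 1) ≤ γ * d k)
    (h0 : dist (u 0) a + C * d 0 / (1 - γ) ≤ ε) (k : ℕ) :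
    dist (u k) a ≤ ε ∧ d k ≤ γ ^ k * d 0 := by
  have h1γ : 0 < 1 - γ := sub_pos.2 hγ1
  have hV (j : ℕ) (hj : dist (u j) a + C * d j / (1 - γ) ≤ ε) : dist (u j) a ≤ ε :=
    (le_add_of_nonneg_right (by have := hd j; positivity)).trans hj
  suffices h : dist (u k) a + C * d k / (1 - γ) ≤ ε ∧ d k ≤ γ ^ k * d 0 from
    ⟨hV k h.1, h.2⟩
  induction k with
  | zero => exact ⟨h0, by simp⟩
  | succ k ih =>
    obtain ⟨hmove, hdec⟩ := hstep k (hV k ih.1)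
    constructor
    · calc dist (u (k + 1)) a + C * d (k + 1) / (1 - γ)
          ≤ (dist (u (k + 1)) (u k) + dist (u k) a) + C * (γ * d k) / (1 - γ) := by
            gcongr
            exact dist_triangle ..
        _ ≤ (C * d k + dist (u k) a) + C * (γ * d k) / (1 - γ) := by gcongr
        _ = dist (u k) a + C * d k / (1 - γ) := by field_simp; ring
        _ ≤ ε := ih.1
    · calc d (k + 1) ≤ γ * d k := hdec
        _ ≤ γ * (γ ^ k * d 0) := by gcongr; exact ih.2
        _ = γ ^ (k + 1) * d 0 := by ring

section Phase

theorem phase_eq_normalize (y : ℂ) : phase y = NormedSpace.normalize y := by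
  rw [phase, NormedSpace.normalize, Complex.real_smul, Complex.ofReal_inv, div_eq_inv_mul]

theorem norm_phase {y : ℂ} (hy : y ≠ 0) : ‖phase y‖ = 1 := by
  rw [phase_eq_normalize, NormedSpace.norm_normalize hy]

theorem norm_mul_phase (y : ℂ) : (‖y‖ : ℂ) * phase y = y := by
  rw [phase_eq_normalize, ← Complex.real_smul, NormedSpace.norm_smul_normalize]

theorem phase_ofReal_mul_of_pos {r : ℝ} (hr : 0 < r) (y : ℂ) : phase (r * y) = phase y := by
  rw [phase_eq_normalize, phase_eq_normalize, ← Complex.real_smul,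
    NormedSpace.normalize_smul_of_pos hr]

theorem phase_phase (y : ℂ) : phase (phase y) = phase y := by
  rw [phase_eq_normalize, phase_eq_normalize, NormedSpace.normalize_normalize]

theorem phase_mul_of_norm_eq_one {α : ℂ} (hα : ‖α‖ = 1) (y : ℂ) :
    phase (α * y) = α * phase y := by
  rw [phase, phase, norm_mul, hα, one_mul, mul_div_assoc]

end Phase

section Stacked

variable {G : Type*} {m : ℕ}

@[simp] theorem stack_fst (x : EuclideanSpace ℂ G) (y : EuclideanSpace ℂ (Fin m)) :
    (stack x y).fst = x := rfl

@[simp] theorem stack_snd (x : EuclideanSpace ℂ G) (y : EuclideanSpace ℂ (Fin m)) :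
    (stack x y).snd = y := rfl

theorem stacked_ext {z w : Stacked G m} (h₁ : z.fst = w.fst) (h₂ : ∀ i, z.snd i = w.snd i) :
    z = w :=
  WithLp.ofLp_injective 2 (Prod.ext h₁ (PiLp.ext h₂))

theorem eventually_snd_ne_zero {z : Stacked G m} (hz : ∀ i, z.snd i ≠ 0) :
    ∀ᶠ p in 𝓝 z, ∀ i, p.snd i ≠ 0 :=
  eventually_all.2 fun i =>
    (PiLp.proj 2 _ i ∘L WithLp.sndL 2 ℝ _ _).continuous.continuousAt.eventually_ne (hz i)

theorem hasStrictFDerivAt_stacked [Finite G] {E : Type*} [NormedAddCommGroup E] [NormedSpace ℝ E]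
    {f : E → Stacked G m} {f' : E →L[ℝ] Stacked G m} {x : E}
    (hfst : HasStrictFDerivAt (fun w => (f w).fst) (WithLp.fstL 2 ℝ _ _ ∘L f') x)
    (hsnd : ∀ i, HasStrictFDerivAt (fun w => (f w).snd i)
      (PiLp.proj 2 _ i ∘L WithLp.sndL 2 ℝ _ _ ∘L f') x) :
    HasStrictFDerivAt f f' x := by
  have := Fintype.ofFinite G
  have hsnd' : HasStrictFDerivAt (fun w => (f w).snd) (WithLp.sndL 2 ℝ _ _ ∘L f') x :=
    (hasStrictFDerivAt_piLp 2).2 hsnd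
  exact (WithLp.prodContinuousLinearEquiv 2 ℝ _ _).comp_hasStrictFDerivAt_iff.1
    (hfst.prodMk hsnd')

/-- The displacements `(0, θ ∘ y / |y|)` that rescale the entries of `y` in `z = (x, y)`, keeping
their phases. -/
def radial (z : Stacked G m) : (Fin m → ℝ) →ₗ[ℝ] Stacked G m where
  toFun θ := stack 0 (WithLp.toLp 2 fun i => (θ i : ℂ) * phase (z.snd i))
  map_add' θ η := stacked_ext (by simp) (by simp [add_mul])
  map_smul' r θ := stacked_ext (by simp) (by simp [mul_assoc])

@[simp] theorem radial_fst (z : Stacked G m) (θ : Fin m → ℝ) : (radial z θ).fst = 0 := rfl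

@[simp] theorem radial_snd_apply (z : Stacked G m) (θ : Fin m → ℝ) (i : Fin m) :
    (radial z θ).snd i = θ i * phase (z.snd i) := rfl

theorem radial_injective {z : Stacked G m} (hz : ∀ i, z.snd i ≠ 0) :
    Function.Injective (radial z) := by
  intro θ η h
  ext i
  have hi : (radial z θ).snd i = (radial z η).snd i := by rw [h]
  have hphase : phase (z.snd i) ≠ 0 := norm_ne_zero_iff.1 (by simp [norm_phase (hz i)])
  exact Complex.ofReal_injective (mul_right_cancel₀ hphase hi)

/-- The proximity operator of `(x, y) ↦ f y + g x` for `f` the indicator function of `|y| = b` and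
`g = 0`. -/
def prox (b : Fin m → ℝ) (z : Stacked G m) : Stacked G m := stack z.fst (proxF b z.snd)

theorem prox_smul (b : Fin m → ℝ) (α : Circle) (z : Stacked G m) :
    prox b (α • z) = α • prox b z := by
  refine stacked_ext rfl fun i => ?_
  simp [prox, proxF, Circle.smul_def, phase_mul_of_norm_eq_one (Circle.norm_coe α),
    mul_left_comm]

theorem real_inner_stacked [Fintype G] (z w : Stacked G m) :
    ⟪z, w⟫ = ⟪z.fst, w.fst⟫ + ∑ i, ⟪z.snd i, w.snd i⟫ := rfl

theorem inner_stacked [Fintype G] (z w : Stacked G m) :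
    inner ℂ z w = inner ℂ z.fst w.fst + ∑ i, inner ℂ (z.snd i) (w.snd i) := rfl

theorem real_inner_eq_re_inner_stacked [Fintype G] (z w : Stacked G m) :
    ⟪z, w⟫ = (inner ℂ z w).re := by
  simp [WithLp.prod_inner_apply, PiLp.inner_apply]

end Stacked

variable {G : Type*} [Fintype G] {m : ℕ}

section Tangent

variable (A : Matrix G (Fin m) ℂ)

/-- The graph set `{(x, y) | A* x = y}` as a real subspace: the magnitude constraint is only
real-differentiable. -/
def realGraph : Submodule ℝ (Stacked G m) := (graphSet A).restrictScalars ℝ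

theorem starProjection_realGraph (z : Stacked G m) :
    (realGraph A).starProjection z = graphProj A z := by
  refine Submodule.eq_starProjection_of_mem_of_inner_eq_zero (K := realGraph A)
    ((graphSet A).starProjection_apply_mem z) fun w hw => ?_
  rw [real_inner_eq_re_inner_stacked]
  exact congrArg Complex.re ((graphSet A).starProjection_inner_eq_zero z w hw)

/-- The tangent space at `z = (x, y)` of the set of pairs whose second components have the
entrywise moduli of `y`. It is encoded through its normal space, the radial displacements. -/
def magnitudeTangent (z : Stacked G m) : Submodule ℝ (Stacked G m) :=
  (LinearMap.range (radial z))ᗮ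

theorem real_inner_radial (z v : Stacked G m) (θ : Fin m → ℝ) :
    ⟪radial z θ, v⟫ = ∑ i, θ i * ⟪phase (z.snd i), v.snd i⟫ := by
  simp only [real_inner_stacked, radial_fst, inner_zero_left, zero_add, radial_snd_apply,
    ← Complex.real_smul, real_inner_smul_left]

theorem mem_magnitudeTangent {z v : Stacked G m} :
    v ∈ magnitudeTangent z ↔ ∀ i, ⟪phase (z.snd i), v.snd i⟫ = 0 := by
  rw [magnitudeTangent, Submodule.mem_orthogonal]
  constructor
  · intro h i
    have hi := h _ ⟨Pi.single i 1, rfl⟩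
    rw [real_inner_radial] at hi
    simpa only [Pi.single_apply, ite_mul, one_mul, zero_mul, Finset.sum_ite_eq',
      Finset.mem_univ, if_true] using hi
  · rintro h _ ⟨θ, rfl⟩
    simp only [real_inner_radial, h, mul_zero, Finset.sum_const_zero]

theorem orthogonal_magnitudeTangent (z : Stacked G m) :
    (magnitudeTangent z)ᗮ = LinearMap.range (radial z) :=
  (LinearMap.range (radial z)).orthogonal_orthogonal

theorem starProjection_magnitudeTangent {z : Stacked G m} (hz : ∀ i, z.snd i ≠ 0)
    (v : Stacked G m) :
    (magnitudeTangent z).starProjection v =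
      v - radial z fun i => ⟪phase (z.snd i), v.snd i⟫ := by
  refine Submodule.eq_starProjection_of_mem_orthogonal (K := magnitudeTangent z)
    (mem_magnitudeTangent.2 fun i => ?_) ?_
  · rw [WithLp.sub_snd, PiLp.sub_apply, radial_snd_apply, ← Complex.real_smul, inner_sub_right,
      real_inner_smul_right, real_inner_self_eq_norm_sq, norm_phase (hz i)]
    ring
  · rw [sub_sub_cancel, orthogonal_magnitudeTangent]
    exact ⟨_, rfl⟩

theorem hasStrictFDerivAt_mul_phase {r : ℝ} {y : ℂ} (hy : y ≠ 0) (hr : ‖y‖ = r) :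
    HasStrictFDerivAt (fun w : ℂ => (r : ℂ) * phase w)
      (.id ℝ ℂ - (innerSL ℝ (phase y)).smulRight (phase y)) y := by
  have h := (hasStrictFDerivAt_normalize hy).const_smul r
  rw [← hr, smul_inv_smul₀ (norm_ne_zero_iff.2 hy)] at h
  simp only [← hr, phase_eq_normalize, ← Complex.real_smul]
  exact h

theorem hasStrictFDerivAt_prox {b : Fin m → ℝ} {z : Stacked G m} (hz : ∀ i, z.snd i ≠ 0)
    (hb : ∀ i, ‖z.snd i‖ = b i) :
    HasStrictFDerivAt (𝕜 := ℝ) (prox b) ((magnitudeTangent z).starProjection) z := by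
  refine hasStrictFDerivAt_stacked ?_ fun i => ?_
  · refine (WithLp.fstL 2 ℝ _ _).hasStrictFDerivAt.congr_fderiv ?_
    ext v
    simp [starProjection_magnitudeTangent hz]
  · refine ((hasStrictFDerivAt_mul_phase (hz i) (hb i)).comp z
      (PiLp.proj 2 _ i ∘L WithLp.sndL 2 ℝ _ _).hasStrictFDerivAt).congr_fderiv ?_
    ext v
    simp [starProjection_magnitudeTangent hz]

end Tangent

section Solution

variable (A : Matrix G (Fin m) ℂ)

theorem meas_sub (x w : EuclideanSpace ℂ G) : meas A (x - w) = meas A x - meas A w := by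
  simp [meas, Matrix.mulVec_sub]

theorem meas_smul (c : ℂ) (x : EuclideanSpace ℂ G) : meas A (c • x) = c • meas A x := by
  simp [meas, Matrix.mulVec_smul]

theorem real_inner_meas (x : EuclideanSpace ℂ G) (y : EuclideanSpace ℂ (Fin m)) :
    ⟪meas A x, y⟫ = ⟪x, WithLp.toLp 2 (A *ᵥ y.ofLp)⟫ := by
  have h : inner ℂ (meas A x) y = inner ℂ x (WithLp.toLp 2 (A *ᵥ y.ofLp)) := by
    rw [EuclideanSpace.inner_eq_star_dotProduct, EuclideanSpace.inner_eq_star_dotProduct, meas,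
      Matrix.star_mulVec, Matrix.conjTranspose_conjTranspose, dotProduct_comm,
      ← Matrix.dotProduct_mulVec, dotProduct_comm]
  have h' := congrArg Complex.re h
  simpa [PiLp.inner_apply] using h'

/-- The point `(x, A* x)` of the graph set; for `x = x♮` it is the limit point `z♮`. -/
def graphPoint (x : EuclideanSpace ℂ G) : Stacked G m := stack x (meas A x)

theorem mem_realGraph {A : Matrix G (Fin m) ℂ} {z : Stacked G m} :
    z ∈ realGraph A ↔ graphPoint A z.fst = z :=
  ⟨fun h => stacked_ext rfl fun i => congrArg (· i) h, fun h => congrArg WithLp.snd h⟩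

theorem graphPoint_smul (c : ℂ) (x : EuclideanSpace ℂ G) :
    graphPoint A (c • x) = c • graphPoint A x :=
  stacked_ext rfl fun i => by simp [graphPoint, meas_smul]

theorem stack_zero_mem_orthogonal_realGraph {A : Matrix G (Fin m) ℂ}
    {y : EuclideanSpace ℂ (Fin m)} :
    stack 0 y ∈ (realGraph A)ᗮ ↔ A *ᵥ y.ofLp = 0 := by
  have hinner (x : EuclideanSpace ℂ G) :
      ⟪graphPoint A x, stack 0 y⟫ = ⟪x, WithLp.toLp 2 (A *ᵥ y.ofLp)⟫ := by
    rw [← real_inner_meas, WithLp.prod_inner_apply, graphPoint]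
    simp [stack]
  constructor
  · intro h
    have hzero := (hinner (WithLp.toLp 2 (A *ᵥ y.ofLp))).symm.trans (h _ rfl)
    simpa using inner_self_eq_zero.1 hzero
  · intro h w hw
    rw [← mem_realGraph.1 hw, hinner, h, WithLp.toLp_zero, inner_zero_right]

theorem eventually_phase_sub_eq {y u : ℂ} (hy : y ≠ 0) (hu : ⟪phase y, u⟫ = 0) :
    ∀ᶠ s : ℝ in 𝓝 0, phase (y - s * Complex.I * u) = phase y := by
  obtain ⟨τ, hτ⟩ : ∃ τ : ℝ, u = τ * Complex.I * phase y := by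
    refine ⟨(conj (phase y) * u).im, ?_⟩
    have himag : conj (phase y) * u = (conj (phase y) * u).im * Complex.I := by
      refine Complex.ext ?_ (by simp)
      rw [Complex.inner, mul_comm] at hu
      simpa using hu
    rw [← himag, mul_right_comm, ← Complex.normSq_eq_conj_mul_self, Complex.normSq_eq_norm_sq,
      norm_phase hy]
    simp
  have hpos : ∀ᶠ s : ℝ in 𝓝 0, 0 < ‖y‖ + s * τ := by
    have hcont : ContinuousAt (fun s : ℝ => ‖y‖ + s * τ) 0 := by fun_prop
    exact hcont.eventually_const_lt (by simpa using hy)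
  filter_upwards [hpos] with s hs
  have hsplit : y - s * Complex.I * u = ((‖y‖ + s * τ : ℝ) : ℂ) * phase y := by
    rw [hτ]
    push_cast
    linear_combination -norm_mul_phase y - s * τ * phase y * Complex.I_sq
  rw [hsplit, phase_ofReal_mul_of_pos hs, phase_phase]

/-- The phases of the entries of `A* x` determine `x` up to a real factor, i.e. magnitude
retrieval is uniquely solvable. -/
def PhaseDetermines (A : Matrix G (Fin m) ℂ) (x : EuclideanSpace ℂ G) : Prop :=
  ∀ x', (∀ i, phase (meas A x' i) = phase (meas A x i)) → ∃ c : ℝ, x' = (c : ℂ) • x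

theorem realGraph_inf_magnitudeTangent_le {A : Matrix G (Fin m) ℂ} {xnat : EuclideanSpace ℂ G}
    (hy : ∀ i, meas A xnat i ≠ 0) (hmag : PhaseDetermines A xnat) :
    realGraph A ⊓ magnitudeTangent (graphPoint A xnat) ≤ ℝ ∙ (Complex.I • graphPoint A xnat) := by
  rintro v ⟨hgraph, htan⟩
  have hgraph' : meas A v.fst = v.snd := hgraph
  have hphase : ∀ᶠ s : ℝ in 𝓝 0, ∀ i,
      phase (meas A (xnat - (s * Complex.I) • v.fst) i) = phase (meas A xnat i) := by
    refine eventually_all.2 fun i => ?_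
    simpa [meas_sub, meas_smul, hgraph'] using
      eventually_phase_sub_eq (hy i) (mem_magnitudeTangent.1 htan i)
  obtain ⟨s, hs, hs0⟩ :=
    ((hphase.filter_mono nhdsWithin_le_nhds).and (self_mem_nhdsWithin (s := {0}ᶜ))).exists
  obtain ⟨c, hc⟩ := hmag _ hs
  have hs0' : (s : ℂ) ≠ 0 := Complex.ofReal_ne_zero.2 hs0
  have hfst : v.fst = (((c - 1) / s : ℝ) : ℂ) • Complex.I • xnat := by
    have hsI : (s * Complex.I) • v.fst = ((1 - c : ℝ) : ℂ) • xnat := by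
      rw [Complex.ofReal_sub, sub_smul, ← hc]
      simp
    have hI : (s : ℂ) • v.fst = ((c - 1 : ℝ) : ℂ) • Complex.I • xnat :=
      calc (s : ℂ) • v.fst = -(Complex.I • (s * Complex.I) • v.fst) := by
            rw [smul_smul, ← neg_smul]
            congr 1
            linear_combination s * Complex.I_sq
        _ = ((c - 1 : ℝ) : ℂ) • Complex.I • xnat := by
            rw [hsI]
            push_cast
            module
    rw [Complex.ofReal_div, div_eq_inv_mul, mul_smul, ← hI, inv_smul_smul₀ hs0']
  rw [Submodule.mem_span_singleton]
  refine ⟨(c - 1) / s, ?_⟩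
  rw [← mem_realGraph.1 hgraph, hfst, graphPoint_smul, graphPoint_smul, Complex.coe_smul]

end Solution

section GPS

variable (A : Matrix G (Fin m) ℂ) (b : Fin m → ℝ)

/-- One step of graph projection splitting with `g = 0` in the variable
`z_DR = (lam + x, nu + y)`. -/
def gpsStep : Stacked G m → Stacked G m := douglasRachford (realGraph A) (prox b)

theorem gpsStep_smul (α : Circle) (z : Stacked G m) :
    gpsStep A b (α • z) = α • gpsStep A b z := by
  simp only [gpsStep, douglasRachford, prox_smul, starProjection_realGraph, graphProj]
  simp only [Circle.smul_def, smul_comm 2 (α : ℂ), ← smul_sub, map_smul, ← smul_add]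

theorem IsGPS.lam_succ {A : Matrix G (Fin m) ℂ} {b : Fin m → ℝ}
    {x xh lam : ℕ → EuclideanSpace ℂ G} {y yh nu : ℕ → EuclideanSpace ℂ (Fin m)}
    (h : IsGPS A b x xh lam y yh nu) (k : ℕ) : lam (k + 1) = 0 := by
  rw [h.dual_x, h.prox_x, proxG]
  abel

theorem IsGPS.gpsStep_eq {A : Matrix G (Fin m) ℂ} {b : Fin m → ℝ}
    {x xh lam : ℕ → EuclideanSpace ℂ G} {y yh nu : ℕ → EuclideanSpace ℂ (Fin m)}
    (h : IsGPS A b x xh lam y yh nu) (k : ℕ) :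
    gpsStep A b (stack (lam (k + 1) + x (k + 1)) (nu (k + 1) + y (k + 1))) =
      stack (lam (k + 2) + x (k + 2)) (nu (k + 2) + y (k + 2)) := by
  have hdual : nu (k + 1) + y (k + 1) = yh k + nu k := by rw [h.dual_y]; abel
  have hprox : prox b (stack (lam (k + 1) + x (k + 1)) (nu (k + 1) + y (k + 1))) =
      stack (x (k + 1)) (y (k + 1)) := by
    rw [prox, stack_fst, stack_snd, hdual, ← h.prox_y, h.lam_succ, zero_add]
  have hreflect : 2 • stack (x (k + 1)) (y (k + 1)) -
      stack (lam (k + 1) + x (k + 1)) (nu (k + 1) + y (k + 1)) =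
      stack (x (k + 1) - lam (k + 1)) (y (k + 1) - nu (k + 1)) := by
    refine stacked_ext ?_ fun i => ?_
    · simp only [WithLp.sub_fst, WithLp.smul_fst, stack_fst]
      module
    · simp only [WithLp.sub_snd, WithLp.smul_snd, stack_snd, PiLp.sub_apply, PiLp.smul_apply,
        nsmul_eq_mul, Nat.cast_ofNat, PiLp.add_apply]
      ring
  rw [gpsStep, douglasRachford, hprox, hreflect, starProjection_realGraph, ← h.graph_step]
  refine stacked_ext ?_ fun i => ?_
  · simp [h.dual_x (k + 1)]
  · simp [h.dual_y (k + 1)]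

end GPS

section FixedSet

variable (A : Matrix G (Fin m) ℂ) (b : Fin m → ℝ) (xnat : EuclideanSpace ℂ G)

/-- The points of `𝓕` with `α = 1`. The first condition on `θ` is `A (θ ∘ y♮ / |y♮|) = 0`, written
as orthogonality to the graph set. -/
def fixedSlice : Set (Stacked G m) :=
  (fun θ => graphPoint A xnat + radial (graphPoint A xnat) θ) ''
    {θ | radial (graphPoint A xnat) θ ∈ (realGraph A)ᗮ ∧ ∀ i, 0 ≤ b i + θ i}

theorem isClosed_fixedSlice (hy : ∀ i, meas A xnat i ≠ 0) : IsClosed (fixedSlice A b xnat) := by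
  have hcont : Continuous (radial (graphPoint A xnat)) :=
    LinearMap.continuous_of_finiteDimensional _
  have hclosed : IsClosed
      {θ | radial (graphPoint A xnat) θ ∈ (realGraph A)ᗮ ∧ ∀ i, 0 ≤ b i + θ i} := by
    refine ((realGraph A).isClosed_orthogonal.preimage hcont).inter ?_
    exact (isClosed_Ici (a := (0 : Fin m → ℝ))).preimage (f := fun θ => b + θ) (by fun_prop)
  refine ((Homeomorph.addLeft (graphPoint A xnat)).isClosedEmbedding.comp
    (LinearMap.isClosedEmbedding_of_injective (LinearMap.ker_eq_bot.2 ?_))).isClosedMap _ hclosed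
  exact radial_injective hy

theorem snd_graphPoint_add_radial {A : Matrix G (Fin m) ℂ} {b : Fin m → ℝ}
    {xnat : EuclideanSpace ℂ G} (hsol : IsSolution A b xnat) (θ : Fin m → ℝ) (i : Fin m) :
    (graphPoint A xnat + radial (graphPoint A xnat) θ).snd i =
      ((b i + θ i : ℝ) : ℂ) * phase (meas A xnat i) := by
  have hyi : (b i : ℂ) * phase (meas A xnat i) = meas A xnat i := by
    rw [← hsol i, norm_mul_phase]
  rw [Complex.ofReal_add, add_mul, hyi]
  rfl

theorem fixedSet_eq_smul_fixedSlice (hsol : IsSolution A b xnat) :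
    fixedSet A b xnat = (Set.univ : Set Circle) • fixedSlice A b xnat := by
  have hpoint (α : Circle) (θ : Fin m → ℝ) :
      α • (graphPoint A xnat + radial (graphPoint A xnat) θ) =
      stack ((α : ℂ) • xnat)
        (WithLp.toLp 2 fun i => α * ((b i + θ i : ℝ) : ℂ) * phase (meas A xnat i)) := by
    refine stacked_ext (by simp [Circle.smul_def, graphPoint]) fun i => ?_
    calc α * (graphPoint A xnat + radial (graphPoint A xnat) θ).snd i
        = α * (((b i + θ i : ℝ) : ℂ) * phase (meas A xnat i)) :=
          congrArg ((α : ℂ) * ·) (snd_graphPoint_add_radial hsol θ i)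
      _ = α * ((b i + θ i : ℝ) : ℂ) * phase (meas A xnat i) := (mul_assoc _ _ _).symm
  have horth (θ : Fin m → ℝ) : radial (graphPoint A xnat) θ ∈ (realGraph A)ᗮ ↔
      A *ᵥ (fun i => (θ i : ℂ) * phase (meas A xnat i)) = 0 :=
    stack_zero_mem_orthogonal_realGraph
  ext z
  rw [Set.mem_smul]
  constructor
  · rintro ⟨α, θ, hα, hA, hθ, rfl⟩
    refine ⟨⟨α, mem_sphere_zero_iff_norm.2 hα⟩, Set.mem_univ _, _,
      ⟨θ, ⟨(horth θ).2 hA, hθ⟩, rfl⟩, hpoint _ θ⟩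
  · rintro ⟨α, -, _, ⟨θ, ⟨hA, hθ⟩, rfl⟩, rfl⟩
    exact ⟨α, θ, α.norm_coe, (horth θ).1 hA, hθ, hpoint α θ⟩

theorem isClosed_fixedSet (hy : ∀ i, meas A xnat i ≠ 0) (hsol : IsSolution A b xnat) :
    IsClosed (fixedSet A b xnat) := by
  rw [fixedSet_eq_smul_fixedSlice A b xnat hsol]
  exact isClosed_univ_circle_smul (isClosed_fixedSlice A b xnat hy)

end FixedSet

section Projection

variable {S : Set (Stacked G m)} {z p q : Stacked G m}

theorem exists_isProjOn (hS : IsClosed S) (hne : S.Nonempty) (z : Stacked G m) :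
    ∃ p, IsProjOn S z p := by
  have := FiniteDimensional.proper ℂ (Stacked G m)
  obtain ⟨p, hp, hdist⟩ := hS.exists_infDist_eq_dist hne z
  refine ⟨p, hp, fun q hq => pow_le_pow_left₀ (norm_nonneg _) ?_ 2⟩
  rw [← dist_eq_norm', ← dist_eq_norm', ← hdist]
  exact infDist_le_dist_of_mem hq

theorem IsProjOn.norm_sub_le (h : IsProjOn S z p) (hq : q ∈ S) : ‖z - p‖ ≤ ‖z - q‖ := by
  rw [norm_sub_rev z, norm_sub_rev z]
  exact le_of_sq_le_sq (h.2 q hq) (norm_nonneg _)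

theorem IsProjOn.infDist_eq (h : IsProjOn S z p) : infDist z S = ‖z - p‖ := by
  refine le_antisymm (dist_eq_norm z p ▸ infDist_le_dist_of_mem h.1) ?_
  exact (le_infDist ⟨p, h.1⟩).2 fun _ hq => (h.norm_sub_le hq).trans_eq (dist_eq_norm _ _).symm

theorem IsProjOn.of_circle_smul {α : Circle} (hS : ∀ q ∈ S, α • q ∈ S) (hp : p ∈ S)
    (h : IsProjOn S (α • z) (α • p)) : IsProjOn S z p := by
  refine ⟨hp, fun q hq => ?_⟩
  simpa only [← smul_sub, Circle.norm_smul] using h.2 _ (hS q hq)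

theorem IsProjOn.inner_eq_zero_of_hasDerivAt (h : IsProjOn S z p) {c : ℝ → Stacked G m}
    {c' : Stacked G m} (hc : HasDerivAt c c' 0) (hc0 : c 0 = p) (hS : ∀ᶠ t in 𝓝 0, c t ∈ S) :
    ⟪c', z - p⟫ = 0 := by
  subst hc0
  refine inner_sub_eq_zero_of_isLocalMin_norm_sub hc ?_
  filter_upwards [hS] with t ht
  exact le_of_sq_le_sq (h.2 _ ht) (norm_nonneg _)

end Projection

section Contraction

variable {A : Matrix G (Fin m) ℂ} {b : Fin m → ℝ} {xnat : EuclideanSpace ℂ G}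
  {z p : Stacked G m}

theorem graphPoint_mem_fixedSlice (hb : ∀ i, 0 ≤ b i) : graphPoint A xnat ∈ fixedSlice A b xnat :=
  ⟨0, by simpa using hb, by simp⟩

theorem fixedSlice_subset_fixedSet (hsol : IsSolution A b xnat) :
    fixedSlice A b xnat ⊆ fixedSet A b xnat := by
  rw [fixedSet_eq_smul_fixedSlice A b xnat hsol]
  exact fun q hq => ⟨1, Set.mem_univ _, q, hq, one_smul _ q⟩

theorem circle_smul_mem_fixedSet (hsol : IsSolution A b xnat) (α : Circle)
    (hp : p ∈ fixedSet A b xnat) : α • p ∈ fixedSet A b xnat := by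
  rw [fixedSet_eq_smul_fixedSlice A b xnat hsol] at hp ⊢
  obtain ⟨β, -, q, hq, rfl⟩ := hp
  exact ⟨α * β, Set.mem_univ _, q, hq, mul_smul α β q⟩

theorem phaseDist_fst_le (hp : p ∈ fixedSet A b xnat) (z : Stacked G m) :
    phaseDist z.fst xnat ≤ ‖z - p‖ := by
  obtain ⟨α, θ, hα, -, -, rfl⟩ := hp
  have hbdd : BddBelow (Set.range fun β : Circle => ‖z.fst - (β : ℂ) • xnat‖) :=
    ⟨0, Set.forall_mem_range.2 fun _ => norm_nonneg _⟩
  exact (ciInf_le hbdd ⟨α, mem_sphere_zero_iff_norm.2 hα⟩).trans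
    (WithLp.norm_fst_le _ (z - stack _ _))

theorem IsProjOn.inner_I_smul_eq_zero (hsol : IsSolution A b xnat)
    (h : IsProjOn (fixedSet A b xnat) z p) : ⟪Complex.I • p, z - p⟫ = 0 :=
  h.inner_eq_zero_of_hasDerivAt (hasDerivAt_circle_exp_smul p) (by simp)
    (.of_forall fun _ => circle_smul_mem_fixedSet hsol _ h.1)

theorem pos_of_snd_ne_zero (hsol : IsSolution A b xnat) {θ : Fin m → ℝ} {i : Fin m}
    (hθ : 0 ≤ b i + θ i)
    (h : (graphPoint A xnat + radial (graphPoint A xnat) θ).snd i ≠ 0) : 0 < b i + θ i :=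
  hθ.lt_of_ne fun h0 => h (by rw [snd_graphPoint_add_radial hsol, ← h0, Complex.ofReal_zero,
    zero_mul])

theorem prox_eq_graphPoint (hsol : IsSolution A b xnat) (hp : p ∈ fixedSlice A b xnat)
    (hp0 : ∀ i, p.snd i ≠ 0) : prox b p = graphPoint A xnat := by
  obtain ⟨θ, ⟨-, hθ⟩, rfl⟩ := hp
  refine stacked_ext (by simp [prox, graphPoint]) fun i => ?_
  calc (b i : ℂ) * phase ((graphPoint A xnat + radial (graphPoint A xnat) θ).snd i)
      = ‖meas A xnat i‖ * phase (meas A xnat i) := by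
        rw [snd_graphPoint_add_radial hsol,
          phase_ofReal_mul_of_pos (pos_of_snd_ne_zero hsol (hθ i) (hp0 i)), phase_phase, hsol i]
    _ = meas A xnat i := norm_mul_phase _

theorem gpsStep_eq_self (hsol : IsSolution A b xnat)
    (hp : p ∈ fixedSlice A b xnat) (hp0 : ∀ i, p.snd i ≠ 0) : gpsStep A b p = p := by
  have hprox := prox_eq_graphPoint hsol hp hp0
  obtain ⟨θ, ⟨horth, -⟩, rfl⟩ := hp
  refine douglasRachford_eq_self ?_ ?_
  · rw [hprox]
    exact mem_realGraph.2 rfl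
  · rwa [hprox, add_sub_cancel_left]

theorem IsProjOn.sub_mem_orthogonal (hsol : IsSolution A b xnat)
    (h : IsProjOn (fixedSet A b xnat) z p) (hp : p ∈ fixedSlice A b xnat)
    (hp0 : ∀ i, p.snd i ≠ 0) :
    z - p ∈ ((realGraph A)ᗮ ⊓ (magnitudeTangent (graphPoint A xnat))ᗮ)ᗮ := by
  obtain ⟨θ, ⟨horth, hθ⟩, rfl⟩ := hp
  rintro w ⟨hwK, hwM⟩
  rw [SetLike.mem_coe, orthogonal_magnitudeTangent] at hwM
  obtain ⟨η, rfl⟩ := hwM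
  have hderiv : HasDerivAt (fun t : ℝ => graphPoint A xnat + radial (graphPoint A xnat) θ +
      t • radial (graphPoint A xnat) η) (radial (graphPoint A xnat) η) 0 := by
    simpa only [id, one_smul] using ((hasDerivAt_id (0 : ℝ)).smul_const _).const_add _
  refine h.inner_eq_zero_of_hasDerivAt hderiv (by simp) ?_
  have hpos : ∀ᶠ t : ℝ in 𝓝 0, ∀ i, 0 < b i + (θ i + t * η i) := eventually_all.2 fun i => by
    have hcont : ContinuousAt (fun t : ℝ => b i + (θ i + t * η i)) 0 := by fun_prop
    exact hcont.eventually_const_lt (by simpa using pos_of_snd_ne_zero hsol (hθ i) (hp0 i))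
  filter_upwards [hpos] with t ht
  refine fixedSlice_subset_fixedSet hsol ⟨θ + t • η, ⟨?_, fun i => (ht i).le⟩, ?_⟩
  · rw [map_add, map_smul]
    exact add_mem horth (Submodule.smul_mem _ t hwK)
  · simp [add_assoc]

theorem inner_graphPoint_nonneg (hb : ∀ i, 0 ≤ b i) (hsol : IsSolution A b xnat)
    (hp : p ∈ fixedSlice A b xnat) : 0 ≤ inner ℂ p (graphPoint A xnat) := by
  obtain ⟨θ, ⟨-, hθ⟩, rfl⟩ := hp
  rw [inner_stacked]
  refine add_nonneg ?_ (Finset.sum_nonneg fun i _ => ?_)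
  · have hfst : (graphPoint A xnat + radial (graphPoint A xnat) θ).fst = xnat := add_zero xnat
    rw [hfst, graphPoint, stack_fst, inner_self_eq_norm_sq_to_K]
    positivity
  · have hz₀ : (graphPoint A xnat).snd i = b i * phase (meas A xnat i) := by
      rw [← hsol i, norm_mul_phase]
      rfl
    calc 0 ≤ ((b i * (b i + θ i) * Complex.normSq (phase (meas A xnat i)) : ℝ) : ℂ) :=
          Complex.zero_le_real.2
            (mul_nonneg (mul_nonneg (hb i) (hθ i)) (Complex.normSq_nonneg _))
      _ = _ := by
        rw [snd_graphPoint_add_radial hsol, hz₀, RCLike.inner_apply, map_mul, Complex.conj_ofReal,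
          Complex.ofReal_mul, Complex.normSq_eq_conj_mul_self, Complex.ofReal_mul]
        ring

theorem IsProjOn.norm_starProjection_mul_norm_graphPoint_le (hsol : IsSolution A b xnat)
    (h : IsProjOn (fixedSet A b xnat) z p) {N : Submodule ℝ (Stacked G m)}
    (hN : N ≤ ℝ ∙ (Complex.I • graphPoint A xnat)) :
    ‖N.starProjection (z - p)‖ * ‖graphPoint A xnat‖ ≤ ‖graphPoint A xnat - p‖ * ‖z - p‖ := by
  have hI (w : Stacked G m) : ‖Complex.I • w‖ = ‖w‖ := by rw [norm_smul, Complex.norm_I, one_mul]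
  calc ‖N.starProjection (z - p)‖ * ‖graphPoint A xnat‖
      ≤ |⟪Complex.I • graphPoint A xnat, z - p⟫| := by
        rw [← hI (graphPoint A xnat)]
        exact norm_starProjection_mul_norm_le hN _
    _ = |⟪Complex.I • (graphPoint A xnat - p), z - p⟫| := by
        rw [smul_sub, inner_sub_left, h.inner_I_smul_eq_zero hsol, sub_zero]
    _ ≤ ‖graphPoint A xnat - p‖ * ‖z - p‖ := by
        rw [← hI (graphPoint A xnat - p)]
        exact abs_real_inner_le_norm _ _

theorem hasStrictFDerivAt_gpsStep (hz : ∀ i, z.snd i ≠ 0) (hb : ∀ i, ‖z.snd i‖ = b i) :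
    HasStrictFDerivAt (𝕜 := ℝ) (gpsStep A b)
      (douglasRachfordCLM (realGraph A) (magnitudeTangent z).starProjection) z :=
  hasStrictFDerivAt_douglasRachford _ (hasStrictFDerivAt_prox hz hb)

theorem exists_eventually_norm_gpsStep_sub_le (hb : ∀ i, 0 < b i)
    (hsol : IsSolution A b xnat) (hz₀ : graphPoint A xnat ≠ 0) (hmag : PhaseDetermines A xnat) :
    ∃ γ, 0 < γ ∧ γ < 1 ∧
      ∀ᶠ w : Stacked G m × Stacked G m in 𝓝 (graphPoint A xnat, graphPoint A xnat),
        w.2 ∈ fixedSlice A b xnat → IsProjOn (fixedSet A b xnat) w.1 w.2 →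
          ‖gpsStep A b w.1 - w.2‖ ≤ γ * ‖w.1 - w.2‖ := by
  have hy (i : Fin m) : meas A xnat i ≠ 0 := norm_ne_zero_iff.1 (hsol i ▸ (hb i).ne')
  obtain ⟨γ, hγ0, hγ1, hlin⟩ := exists_norm_douglasRachfordCLM_le (realGraph A)
    (magnitudeTangent (graphPoint A xnat))
  obtain ⟨δ, hδ0, hδ⟩ : ∃ δ > 0, γ + 2 * δ < 1 := ⟨(1 - γ) / 4, by linarith, by linarith⟩
  refine ⟨γ + 2 * δ, by linarith, hδ, ?_⟩
  have hstrict :=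
    (hasStrictFDerivAt_gpsStep (A := A) (z := graphPoint A xnat) hy hsol).isLittleO.def hδ0
  have hsnd := (continuousAt_snd (p := (graphPoint A xnat, graphPoint A xnat))).eventually
    (eventually_snd_ne_zero hy)
  have hnear := (continuousAt_snd (p := (graphPoint A xnat, graphPoint A xnat))).eventually
    (ball_mem_nhds _ (mul_pos hδ0 (norm_pos_iff.2 hz₀)))
  filter_upwards [hstrict, hsnd, hnear] with w hw hw0 hnear hslice hproj
  rw [gpsStep_eq_self hsol hslice hw0] at hw
  have hT := hlin (w.1 - w.2) (hproj.sub_mem_orthogonal hsol hslice hw0)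
  have hKM : ‖(realGraph A ⊓ magnitudeTangent (graphPoint A xnat)).starProjection (w.1 - w.2)‖ ≤
      δ * ‖w.1 - w.2‖ := by
    refine le_of_mul_le_mul_right ?_ (norm_pos_iff.2 hz₀)
    calc _ ≤ ‖graphPoint A xnat - w.2‖ * ‖w.1 - w.2‖ :=
          hproj.norm_starProjection_mul_norm_graphPoint_le hsol
            (realGraph_inf_magnitudeTangent_le hy hmag)
      _ ≤ δ * ‖graphPoint A xnat‖ * ‖w.1 - w.2‖ := by
          gcongr
          exact (mem_ball_iff_norm'.1 hnear).le
      _ = δ * ‖w.1 - w.2‖ * ‖graphPoint A xnat‖ := by ring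
  refine (norm_le_norm_add_norm_sub' _ _).trans ((add_le_add hT hw).trans ?_)
  linarith

theorem exists_norm_gpsStep_sub_le (hb : ∀ i, 0 < b i) (hsol : IsSolution A b xnat)
    (hz₀ : graphPoint A xnat ≠ 0) (hmag : PhaseDetermines A xnat) :
    ∃ γ, 0 < γ ∧ γ < 1 ∧ ∃ ε > 0, ∀ z p, ‖z - graphPoint A xnat‖ ≤ ε →
      IsProjOn (fixedSet A b xnat) z p → ‖gpsStep A b z - p‖ ≤ γ * ‖z - p‖ := by
  obtain ⟨γ, hγ0, hγ1, hslice⟩ := exists_eventually_norm_gpsStep_sub_le hb hsol hz₀ hmag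
  obtain ⟨ε, hε, hball⟩ := Metric.eventually_nhds_iff.1 hslice
  refine ⟨γ, hγ0, hγ1, ε / 4, by positivity, fun z p hz hproj => ?_⟩
  have hz₀F := fixedSlice_subset_fixedSet hsol (graphPoint_mem_fixedSlice fun i => (hb i).le)
  obtain ⟨α, -, q, hq, rfl⟩ := fixedSet_eq_smul_fixedSlice A b xnat hsol ▸ hproj.1
  obtain ⟨w, rfl⟩ : ∃ w, z = α • w := ⟨α⁻¹ • z, (smul_inv_smul α z).symm⟩
  have hproj' : IsProjOn (fixedSet A b xnat) w q :=
    hproj.of_circle_smul (fun _ => circle_smul_mem_fixedSet hsol α)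
      (fixedSlice_subset_fixedSet hsol hq)
  have hdist : ‖w - q‖ ≤ ε / 4 := by
    rw [← Circle.norm_smul α, smul_sub]
    exact (hproj.norm_sub_le hz₀F).trans hz
  have hqz₀ : ‖q - graphPoint A xnat‖ ≤ ε / 2 :=
    calc ‖q - graphPoint A xnat‖ ≤ ‖α • q - graphPoint A xnat‖ :=
          norm_sub_le_norm_circle_smul_sub (inner_graphPoint_nonneg (fun i => (hb i).le) hsol hq) α
      _ ≤ ‖α • q - α • w‖ + ‖α • w - graphPoint A xnat‖ := norm_sub_le_norm_sub_add_norm_sub ..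
      _ ≤ ε / 4 + ε / 4 := by
          rw [← smul_sub, Circle.norm_smul, norm_sub_rev]
          gcongr
      _ = ε / 2 := by ring
  have hwz₀ : ‖w - graphPoint A xnat‖ < ε := by
    linarith [norm_sub_le_norm_sub_add_norm_sub w q (graphPoint A xnat)]
  simpa only [gpsStep_smul, ← smul_sub, Circle.norm_smul] using
    @hball (w, q) (max_lt (by rwa [dist_eq_norm]) (by rw [dist_eq_norm]; linarith)) hq hproj'

theorem exists_infDist_fixedSet_le (hb : ∀ i, 0 < b i) (hsol : IsSolution A b xnat)
    (hz₀ : graphPoint A xnat ≠ 0) (hmag : PhaseDetermines A xnat) :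
    ∃ γ, 0 < γ ∧ γ < 1 ∧ ∃ ε > 0, ∀ u : ℕ → Stacked G m,
      (∀ k, u (k + 1) = gpsStep A b (u k)) → ‖u 0 - graphPoint A xnat‖ ≤ ε →
        ∀ k, infDist (u k) (fixedSet A b xnat) ≤ γ ^ k * infDist (u 0) (fixedSet A b xnat) := by
  have hy (i : Fin m) : meas A xnat i ≠ 0 := norm_ne_zero_iff.1 (hsol i ▸ (hb i).ne')
  have hz₀F := fixedSlice_subset_fixedSet hsol (graphPoint_mem_fixedSlice fun i => (hb i).le)
  have hclosed := isClosed_fixedSet A b xnat hy hsol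
  obtain ⟨γ, hγ0, hγ1, ε, hε, hstep⟩ := exists_norm_gpsStep_sub_le hb hsol hz₀ hmag
  have : 0 < 1 - γ := sub_pos.2 hγ1
  refine ⟨γ, hγ0, hγ1, ε / (1 + 2 / (1 - γ)), by positivity, fun u hu h0 k => ?_⟩
  refine (dist_le_and_le_pow_mul_of_contracting (u := u) (a := graphPoint A xnat) (C := 2)
    (ε := ε) (d := fun j => infDist (u j) (fixedSet A b xnat)) (fun _ => infDist_nonneg)
    zero_le_two hγ0.le hγ1 (fun j hj => ?_) ?_ k).2
  · obtain ⟨p, hp⟩ := exists_isProjOn hclosed ⟨_, hz₀F⟩ (u j)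
    have hcontr := hstep (u j) p (by rwa [← dist_eq_norm]) hp
    rw [hu, hp.infDist_eq]
    constructor
    · rw [dist_eq_norm]
      have hγp : γ * ‖u j - p‖ ≤ ‖u j - p‖ := mul_le_of_le_one_left (norm_nonneg _) hγ1.le
      linarith [norm_sub_le_norm_sub_add_norm_sub (gpsStep A b (u j)) p (u j),
        norm_sub_rev p (u j)]
    · exact (infDist_le_dist_of_mem hp.1).trans ((dist_eq_norm _ _).trans_le hcontr)
  · have hinf : infDist (u 0) (fixedSet A b xnat) ≤ dist (u 0) (graphPoint A xnat) :=
      infDist_le_dist_of_mem hz₀F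
    rw [← dist_eq_norm, le_div_iff₀ (by positivity)] at h0
    calc _ ≤ dist (u 0) (graphPoint A xnat) + 2 * dist (u 0) (graphPoint A xnat) / (1 - γ) := by
          gcongr
      _ = dist (u 0) (graphPoint A xnat) * (1 + 2 / (1 - γ)) := by ring
      _ ≤ ε := h0

end Contraction

theorem bMin_le (b : Fin m → ℝ) (i : Fin m) : bMin b ≤ b i :=
  ciInf_le (Set.finite_range b).bddBelow i

theorem graphPoint_ne_zero {A : Matrix G (Fin m) ℂ} {b : Fin m → ℝ} {xnat : EuclideanSpace ℂ G}
    (hb : 0 < bMin b) (hsol : IsSolution A b xnat) : graphPoint A xnat ≠ 0 := by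
  have hne : Nonempty (Fin m) := by
    by_contra hempty
    rw [not_nonempty_iff] at hempty
    simp [bMin] at hb
  obtain ⟨i⟩ := hne
  intro h
  have hi : meas A xnat i = 0 := congrArg (fun z : Stacked G m => z.snd i) h
  have := hsol i
  rw [hi, norm_zero] at this
  exact (hb.trans_le (bMin_le b i)).ne this

end PhaseRetrieval

end

open PhaseRetrieval in
theorem theorem3p1_general {G : Type*} [Fintype G] {m : ℕ}
    (A : Matrix G (Fin m) ℂ) (b : Fin m → ℝ) (xnat : EuclideanSpace ℂ G)
    (hb : 0 < bMin b) (hsol : IsSolution A b xnat) (hmag : PhaseDetermines A xnat) :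
    ∃ ε₃ : ℝ, 0 < ε₃ ∧ ε₃ < bMin b / 6 ∧ ∃ γ : ℝ, 0 < γ ∧ γ < 1 ∧
      ∀ (x xh lam : ℕ → EuclideanSpace ℂ G) (y yh nu : ℕ → EuclideanSpace ℂ (Fin m)),
        IsGPS A b x xh lam y yh nu →
        ∀ zDR : ℕ → Stacked G m, (∀ k, zDR k = stack (lam k + x k) (nu k + y k)) →
          ‖zDR 1 - stack xnat (meas A xnat)‖ ≤ ε₃ →
          (∃ zstar, IsProjOn (fixedSet A b xnat) (zDR 1) zstar) ∧
          ∀ zstar, IsProjOn (fixedSet A b xnat) (zDR 1) zstar →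
            ∀ k : ℕ, 1 ≤ k →
              phaseDist (x k) xnat ≤ γ ^ (k - 1) * ‖zDR 1 - zstar‖ ∧
              γ ^ (k - 1) * ‖zDR 1 - zstar‖ ≤
                γ ^ (k - 1) * ‖zDR 1 - stack xnat (meas A xnat)‖ := by
  have hb' (i : Fin m) : 0 < b i := hb.trans_le (bMin_le b i)
  obtain ⟨γ, hγ0, hγ1, ε, hε, hdecay⟩ :=
    exists_infDist_fixedSet_le hb' hsol (graphPoint_ne_zero hb hsol) hmag
  have hz₀F := fixedSlice_subset_fixedSet hsol (graphPoint_mem_fixedSlice fun i => (hb' i).le)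
  have hproj := exists_isProjOn
    (isClosed_fixedSet A b xnat (fun i => norm_ne_zero_iff.1 (hsol i ▸ (hb' i).ne')) hsol) ⟨_, hz₀F⟩
  refine ⟨min ε (bMin b / 12), by positivity, (min_le_right _ _).trans_lt (by linarith),
    γ, hγ0, hγ1, fun x xh lam y yh nu hgps zDR hzDR h1 => ⟨hproj _, fun zstar hzstar k hk => ?_⟩⟩
  obtain ⟨k, rfl⟩ := Nat.exists_eq_add_of_le' hk
  obtain ⟨p, hp⟩ := hproj (zDR (k + 1))
  have hx : x (k + 1) = (zDR (k + 1)).fst := by simp [hzDR, hgps.lam_succ]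
  refine ⟨?_, mul_le_mul_of_nonneg_left (hzstar.norm_sub_le hz₀F) (by positivity)⟩
  calc phaseDist (x (k + 1)) xnat ≤ ‖zDR (k + 1) - p‖ := hx ▸ phaseDist_fst_le hp.1 _
    _ = Metric.infDist (zDR (k + 1)) (fixedSet A b xnat) := hp.infDist_eq.symm
    _ ≤ γ ^ k * Metric.infDist (zDR 1) (fixedSet A b xnat) :=
      hdecay (fun j => zDR (j + 1)) (fun j => by rw [hzDR, hzDR, hgps.gpsStep_eq])
        (h1.trans (min_le_left _ _)) k
    _ = γ ^ (k + 1 - 1) * ‖zDR 1 - zstar‖ := by rw [hzstar.infDist_eq, Nat.add_sub_cancel]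

theorem theorem3p1 {G : Type*} [Fintype G] [AddCommGroup G] {m : ℕ}
    (A : Matrix G (Fin m) ℂ) (b : Fin m → ℝ) (xnat : EuclideanSpace ℂ G)
    (hb : 0 < PhaseRetrieval.bMin b)
    (hsol : PhaseRetrieval.IsSolution A b xnat)
    (hA : PhaseRetrieval.SamplingAssumption A b xnat) :
    ∃ ε₃ : ℝ, 0 < ε₃ ∧ ε₃ < PhaseRetrieval.bMin b / 6 ∧
      ∃ γ : ℝ, 0 < γ ∧ γ < 1 ∧
        ∀ (x xh lam : ℕ → EuclideanSpace ℂ G) (y yh nu : ℕ → EuclideanSpace ℂ (Fin m)),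
          PhaseRetrieval.IsGPS A b x xh lam y yh nu →
          ∀ zDR : ℕ → PhaseRetrieval.Stacked G m,
            (∀ k, zDR k = PhaseRetrieval.stack (lam k + x k) (nu k + y k)) →
            ‖zDR 1 - PhaseRetrieval.stack xnat (PhaseRetrieval.meas A xnat)‖ ≤ ε₃ →
            (∃ zstar, PhaseRetrieval.IsProjOn
              (PhaseRetrieval.fixedSet A b xnat) (zDR 1) zstar) ∧
            ∀ zstar, PhaseRetrieval.IsProjOn
                (PhaseRetrieval.fixedSet A b xnat) (zDR 1) zstar →
              ∀ k : ℕ, 1 ≤ k →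
                PhaseRetrieval.phaseDist (x k) xnat ≤ γ ^ (k - 1) * ‖zDR 1 - zstar‖ ∧
                γ ^ (k - 1) * ‖zDR 1 - zstar‖ ≤
                  γ ^ (k - 1) *
                    ‖zDR 1 - PhaseRetrieval.stack xnat (PhaseRetrieval.meas A xnat)‖ :=
  theorem3p1_general A b xnat hb hsol fun x hx =>
    have ⟨c, _, hc⟩ := hA.magnitude_unique x fun i => .inl (hx i)
    ⟨c, hc⟩
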